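/- A Young function is a convex, left-continuous function $\Psi:[0,\infty)\to[0,\infty)$ with $\Psi(0)=0$ and $\lim_{t\to\infty}\Psi(t)=\infty$; put $\Psi^{-1}(s)=\inf\{r\ge 0:\Psi(r)>s\}$ for $s\ge 0$. Write $\Psi_1\prec\Psi_2$ if there is $C>0$ with $\Psi_1(t)\le\Psi_2(Ct)$ for all $t>0$, and, for $\psi_1,\psi_2:(0,\infty)\to(0,\infty)$, write $\psi_1\preceq\psi_2$ if there is $C>0$ with $\psi_1(t)\le C\psi_2(t)$ for all $t>0$. Let $n\ge 1$. For a Young function $\Psi$, let $G_2(\Psi)$ be the set of nondecreasing $\psi:(0,\infty)\to(0,\infty)$ such that for every $s>0$ the function $r\mapsto \psi((r+s)^n)/\Psi^{-1}\big(\big(\tfrac{r+s}{s}\big)^n\big)$ is nonincreasing on $(0,\infty)$. For a Young function $\Psi$ and $\psi\in G_2(\Psi)$, the weak Orlicz–Morrey space $w\mathcal M_{\psi,\Psi}(\mathbb R^n)$ of Sawano–Sugano–Tanaka type is the set of all (Lebesgue) measurable $f:\mathbb R^n\to\mathbb R$ such that $$\|f\|_{w\mathcal M_{\psi,\Psi}(\mathbb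 R^n)}:=\sup_{a\in\mathbb R^n,\ r>0}\psi(|B(a,r)|)\,\|f\|_{w\mathcal M_{\Psi,B(a,r)}}<\infty,$$ where $$\|f\|_{w\mathcal M_{\Psi,B(a,r)}}:=\inf\Big\{b>0:\ \sup_{t>0}\frac{\Psi(t)\,\big|\{x\in B(a,r):|f(x)|/b>t\}\big|}{|B(a,r)|}\le 1\Big\},$$ $B(a,r)$ is the open Euclidean ball, $|\cdot|$ of a set is Lebesgue measure, and $\inf\emptyset=\infty$. **Theorem.** Let $\Psi_1,\Psi_2$ be Young functions with $\Psi_1\prec\Psi_2$, and let $\psi_1\in G_2(\Psi_1)$, $\psi_2\in G_2(\Psi_2)$. Then the following are equivalent: 1. $\psi_1\preceq\psi_2$. 2. $w\mathcal M_{\psi_2,\Psi_2}(\mathbb R^n)\subseteq w\mathcal M_{\psi_1,\Psi_1}(\mathbb R^n)$. 3. There is a constant $C>0$ such that $\|f\|_{w\mathcal M_{\psi_1,\Psi_1}(\mathbb R^n)}\le C\,\|f\|_{w\mathcal M_{\psi_2,\Psi_2}(\mathbb R^n)}$ for every $f\in w\mathcal M_{\psi_2,\Psi_2}(\mathbb R^n)$.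 -/

import Mathlib

open Set Filter Topology MeasureTheory
open scoped ENNReal

namespace OrliczMorrey

/-- Young functions `Φ : [0, ∞) → [0, ∞)`. The function is given on all of `ℝ`, but only its
values on `[0, ∞)` are constrained, and only those are used below. -/
structure IsYoung (Φ : ℝ → ℝ) : Prop where
  nonneg : ∀ t, 0 ≤ t → 0 ≤ Φ t
  convexOn : ConvexOn ℝ (Ici 0) Φ
  leftContinuous : ∀ t, 0 < t → ContinuousWithinAt Φ (Iic t) t
  map_zero : Φ 0 = 0
  tendsto_atTop : Tendsto Φ atTop atTop

/-- The relation `Φ ≺ Ψ`: there is `C > 0` with `Φ t ≤ Ψ (C t)` for all `t > 0`. -/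
def YoungLE (Φ Ψ : ℝ → ℝ) : Prop :=
  ∃ C : ℝ, 0 < C ∧ ∀ t : ℝ, 0 < t → Φ t ≤ Ψ (C * t)

/-- The relation `φ₁ ≼ φ₂`: there is `C > 0` with `φ₁ t ≤ C φ₂ t` for all `t > 0`. -/
def GrowthLE (φ₁ φ₂ : ℝ → ℝ) : Prop :=
  ∃ C : ℝ, 0 < C ∧ ∀ t : ℝ, 0 < t → φ₁ t ≤ C * φ₂ t

/-- The generalized inverse `Φ⁻¹(s) = inf {r ≥ 0 : Φ r > s}`. -/
noncomputable def youngInv (Φ : ℝ → ℝ) (s : ℝ) : ℝ :=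
  sInf {r : ℝ | 0 ≤ r ∧ s < Φ r}

/-- The class `G₂` in dimension `n` relative to the Young function `Ψ`: functions
`ψ : (0, ∞) → (0, ∞)` (only the values on `(0, ∞)` are constrained and used) such that `ψ` is
nondecreasing and, for every `s > 0`, the function
`r ↦ ψ ((r + s) ^ n) / Ψ⁻¹ (((r + s) / s) ^ n)` is nonincreasing on `(0, ∞)`. -/
structure MemG2 (n : ℕ) (Ψ ψ : ℝ → ℝ) : Prop where
  pos : ∀ r, 0 < r → 0 < ψ r
  monotoneOn : MonotoneOn ψ (Ioi 0)
  antitoneOn : ∀ s, 0 < s →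
    AntitoneOn (fun r : ℝ => ψ ((r + s) ^ n) / youngInv Ψ (((r + s) / s) ^ n)) (Ioi 0)

/-- The local weak Luxemburg quasi-norm on the ball `B(a, r)`,
`inf {b > 0 : sup_{t > 0} Ψ(t) |{x ∈ B(a, r) : |f x| / b > t}| / |B(a, r)| ≤ 1}`,
as an extended nonnegative number (the infimum of the empty set is `∞`). -/
noncomputable def weakLocalNorm {n : ℕ} (Ψ : ℝ → ℝ) (f : EuclideanSpace ℝ (Fin n) → ℝ)
    (a : EuclideanSpace ℝ (Fin n)) (r : ℝ) : ℝ≥0∞ :=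
  ⨅ (b : ℝ) (_ : 0 < b ∧
      (⨆ (t : ℝ) (_ : 0 < t),
        ENNReal.ofReal (Ψ t) * volume {x | x ∈ Metric.ball a r ∧ t < |f x| / b}
          / volume (Metric.ball a r)) ≤ 1),
    ENNReal.ofReal b

/-- The weak Orlicz–Morrey quasi-norm
`sup_{a, r > 0} ψ(|B(a, r)|) ‖f‖_{Ψ, B(a, r)}`, with values in `[0, ∞]`. -/
noncomputable def weakNorm {n : ℕ} (ψ Ψ : ℝ → ℝ) (f : EuclideanSpace ℝ (Fin n) → ℝ) : ℝ≥0∞ :=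
  ⨆ (a : EuclideanSpace ℝ (Fin n)) (r : ℝ) (_ : 0 < r),
    ENNReal.ofReal (ψ (volume (Metric.ball a r)).toReal) * weakLocalNorm Ψ f a r

/-- The weak Orlicz–Morrey space on `ℝⁿ`: Lebesgue measurable functions `f : ℝⁿ → ℝ` of finite
quasi-norm. (For real-valued functions, a.e.-measurability with respect to `volume` is the same
as Lebesgue measurability.) -/
def weakSpace (n : ℕ) (ψ Ψ : ℝ → ℝ) : Set (EuclideanSpace ℝ (Fin n) → ℝ) :=
  {f | AEMeasurable f volume ∧ weakNorm ψ Ψ f < ∞}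

end OrliczMorrey

/-! Rescaling levels by the constant of `YoungLE` compares local norms, so 1 gives 3, and 3 gives 2
at once. For 2 ⇒ 1 one function suffices: f(x) = 1/ψ₂(|B(0,‖x‖)|). The `G₂` condition confines the
part of B(a,r) where f exceeds level t (scaled by 1/ψ₂(|B(a,r)|)) to a ball about 0 of volume
|B(a,r)|/Ψ₂(t), so f lies in the second space (`extremal_mem_weakSpace`). Since f ≥ 1/ψ₂(|B(0,r)|)
on B(0,r) off the origin, finiteness of its first norm bounds ψ₁/ψ₂
(`growthLE_of_weakNorm_extremal_lt_top`). -/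

namespace OrliczMorrey

/-! ### Young functions and their generalized inverses. -/

section YoungFunctions

variable {Φ : ℝ → ℝ}

/-- Convexity on the segment from 0 to c * r, with Φ 0 = 0. -/
lemma IsYoung.mul_le_map_mul (h : IsYoung Φ) {c r : ℝ} (hc : 1 ≤ c) (hr : 0 ≤ r) :
    c * Φ r ≤ Φ (c * r) := by
  have hc0 : 0 < c := by linarith
  have key := h.convexOn.2 (mem_Ici.2 le_rfl) (mem_Ici.2 (by positivity : 0 ≤ c * r))
    (sub_nonneg.2 (inv_le_one_of_one_le₀ hc)) (by positivity : 0 ≤ c⁻¹) (by ring)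
  have e : c⁻¹ * (c * r) = r := by field_simp
  simp only [smul_eq_mul, mul_zero, zero_add, h.map_zero, e] at key
  calc c * Φ r ≤ c * (c⁻¹ * Φ (c * r)) := by gcongr
    _ = Φ (c * r) := by field_simp

lemma IsYoung.exists_lt_map (h : IsYoung Φ) (s : ℝ) : ∃ T, 0 < T ∧ ∀ y, T ≤ y → s < Φ y := by
  obtain ⟨T, hT⟩ := (h.tendsto_atTop.eventually_gt_atTop s).exists_forall_of_atTop
  exact ⟨max T 1, by positivity, fun y hy => hT y ((le_max_left _ _).trans hy)⟩

lemma IsYoung.nonempty (h : IsYoung Φ) (s : ℝ) : {r : ℝ | 0 ≤ r ∧ s < Φ r}.Nonempty := by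
  obtain ⟨T, hT, h'⟩ := h.exists_lt_map s
  exact ⟨T, hT.le, h' T le_rfl⟩

lemma bddBelow_youngInv (Φ : ℝ → ℝ) (s : ℝ) : BddBelow {r : ℝ | 0 ≤ r ∧ s < Φ r} :=
  ⟨0, fun _ h => h.1⟩

lemma map_le_of_lt_youngInv {s t : ℝ} (ht : 0 ≤ t) (hts : t < youngInv Φ s) : Φ t ≤ s := by
  by_contra! hcon
  exact notMem_of_lt_csInf hts (bddBelow_youngInv Φ s) ⟨ht, hcon⟩

lemma IsYoung.youngInv_pos (h : IsYoung Φ) {s : ℝ} (hs : 0 < s) : 0 < youngInv Φ s := by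
  have h1 : 0 ≤ Φ 1 := h.nonneg 1 zero_le_one
  -- For r ≤ 1, Φ r ≤ r * Φ 1; the added 1 covers Φ 1 = 0.
  refine lt_of_lt_of_le (lt_min one_pos (by positivity : 0 < s / (Φ 1 + 1)))
    (le_csInf (h.nonempty s) ?_)
  rintro r ⟨hr, hsr⟩
  rw [min_le_iff]
  by_contra! hcon
  obtain ⟨hr1, hr2⟩ := hcon
  have hr0 : 0 < r := hr.lt_of_ne (by rintro rfl; rw [h.map_zero] at hsr; linarith)
  have := h.mul_le_map_mul ((one_le_inv₀ hr0).2 hr1.le) hr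
  rw [inv_mul_cancel₀ hr0.ne', inv_mul_le_iff₀ hr0] at this
  rw [lt_div_iff₀ (by positivity)] at hr2
  nlinarith

lemma IsYoung.youngInv_mul_le (h : IsYoung Φ) {c : ℝ} (hc : 1 ≤ c) (s : ℝ) :
    youngInv Φ (c * s) ≤ c * youngInv Φ s := by
  have hc0 : 0 < c := by linarith
  rw [← div_le_iff₀' hc0]
  refine le_csInf (h.nonempty s) ?_
  rintro r ⟨hr, hsr⟩
  rw [div_le_iff₀' hc0]
  refine csInf_le (bddBelow_youngInv Φ _) ⟨by positivity, ?_⟩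
  exact (mul_lt_mul_of_pos_left hsr hc0).trans_le (h.mul_le_map_mul hc hr)

end YoungFunctions

/-! ### Growth of functions in `G₂`. -/

section Growth

variable {n : ℕ} {Ψ ψ : ℝ → ℝ}

/-- The constant bounding the quasi-norms of normalized indicators of balls. -/
noncomputable def growthConst (n : ℕ) (Ψ : ℝ → ℝ) : ℝ := 2 ^ n / youngInv Ψ (2 ^ n)

lemma growthConst_pos (hΨ : IsYoung Ψ) : 0 < growthConst n Ψ :=
  div_pos (by positivity) (hΨ.youngInv_pos (by positivity))

/-- Lets one constant serve both cases of `MemG2.map_le_one_or`. -/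
lemma inv_youngInv_one_le (hΨ : IsYoung Ψ) : (youngInv Ψ 1)⁻¹ ≤ growthConst n Ψ := by
  have h1 := hΨ.youngInv_pos one_pos
  have h2 : 0 < youngInv Ψ (2 ^ n) := hΨ.youngInv_pos (by positivity)
  have h3 := hΨ.youngInv_mul_le (one_le_pow₀ one_le_two : (1 : ℝ) ≤ 2 ^ n) 1
  rw [mul_one] at h3
  rw [growthConst, inv_eq_one_div, div_le_div_iff₀ h1 h2]
  linarith

lemma MemG2.le_growthConst_mul (hΨ : IsYoung Ψ) (hψ : MemG2 n Ψ ψ) {s m : ℝ} (hs : 0 < s)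
    (hsm : s ≤ m) :
    ψ (m ^ n) ≤ growthConst n Ψ * ψ (s ^ n) * youngInv Ψ ((m / s) ^ n) := by
  have hm : 0 < m := hs.trans_le hsm
  -- The shift s / 2 keeps both arguments positive; it doubles the ratio m / s, which costs the
  -- factor 2 ^ n.
  have key := hψ.antitoneOn (s / 2) (by positivity) (a := s / 2) (b := m - s / 2)
    (by simp only [mem_Ioi]; positivity) (by simp only [mem_Ioi]; linarith) (by linarith)
  have e1 : s / 2 + s / 2 = s := by ring
  have e2 : m - s / 2 + s / 2 = m := by ring
  have e3 : s / (s / 2) = 2 := by field_simp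
  have e4 : (m / (s / 2)) ^ n = 2 ^ n * (m / s) ^ n := by
    rw [← mul_pow]; congr 1; field_simp
  simp only [e1, e2, e3, e4] at key
  have hY : 0 < youngInv Ψ (2 ^ n * (m / s) ^ n) := hΨ.youngInv_pos (by positivity)
  have h2 := hΨ.youngInv_mul_le (one_le_pow₀ one_le_two : (1 : ℝ) ≤ 2 ^ n) ((m / s) ^ n)
  have hY2 : 0 < youngInv Ψ (2 ^ n) := hΨ.youngInv_pos (by positivity)
  have hψs := hψ.pos (s ^ n) (by positivity)
  rw [div_le_iff₀ hY] at key
  calc ψ (m ^ n) ≤ ψ (s ^ n) / youngInv Ψ (2 ^ n) * youngInv Ψ (2 ^ n * (m / s) ^ n) := key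
    _ ≤ ψ (s ^ n) / youngInv Ψ (2 ^ n) * (2 ^ n * youngInv Ψ ((m / s) ^ n)) := by gcongr
    _ = _ := by rw [growthConst]; ring

/-- A level `t` which is small compared to the growth of `ψ` between the volumes `s ^ n` and
`m ^ n` satisfies `Ψ t ≤ 1` or `Ψ t * s ^ n ≤ m ^ n`. -/
lemma MemG2.map_le_one_or (hΨ : IsYoung Ψ) (hψ : MemG2 n Ψ ψ) {s m t : ℝ} (hs : 0 < s)
    (hm : 0 < m) (ht : 0 < t) (h : growthConst n Ψ * t * ψ (s ^ n) < ψ (m ^ n)) :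
    Ψ t ≤ 1 ∨ Ψ t * s ^ n ≤ m ^ n := by
  have hψs := hψ.pos (s ^ n) (by positivity)
  have hK := growthConst_pos (n := n) hΨ
  rcases le_total s m with hsm | hms
  · right
    have h1 := h.trans_le (hψ.le_growthConst_mul hΨ hs hsm)
    have h2 : t < youngInv Ψ ((m / s) ^ n) := by
      refine lt_of_mul_lt_mul_left (a := growthConst n Ψ * ψ (s ^ n)) ?_ (by positivity)
      linarith
    have h3 := map_le_of_lt_youngInv ht.le h2
    rwa [div_pow, le_div_iff₀ (by positivity)] at h3
  · left
    have h1 : ψ (m ^ n) ≤ ψ (s ^ n) := hψ.monotoneOn (pow_pos hm n) (pow_pos hs n) (by gcongr)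
    have h2 : growthConst n Ψ * t < 1 := by
      refine lt_of_mul_lt_mul_right (a := ψ (s ^ n)) ?_ hψs.le
      linarith
    refine map_le_of_lt_youngInv ht.le ?_
    have hY := hΨ.youngInv_pos one_pos
    have h3 : (youngInv Ψ 1)⁻¹ * t < 1 :=
      (mul_le_mul_of_nonneg_right (inv_youngInv_one_le (n := n) hΨ) ht.le).trans_lt h2
    rwa [inv_mul_lt_iff₀ hY, mul_one] at h3

end Growth

/-! ### Volumes of balls. -/

section Balls

/-- The normalizing factor for which balls of radius `r` have volume `(unitScale n * r) ^ n`. -/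
noncomputable def unitScale (n : ℕ) : ℝ :=
  (volume (Metric.ball (0 : EuclideanSpace ℝ (Fin n)) 1)).toReal ^ (n⁻¹ : ℝ)

variable {n : ℕ}

lemma unitScale_pos : 0 < unitScale n :=
  Real.rpow_pos_of_pos (ENNReal.toReal_pos (Metric.measure_ball_pos _ _ one_pos).ne'
    measure_ball_lt_top.ne) _

lemma volume_ball_eq (hn : 1 ≤ n) (a : EuclideanSpace ℝ (Fin n)) {r : ℝ} (hr : 0 ≤ r) :
    volume (Metric.ball a r) = ENNReal.ofReal ((unitScale n * r) ^ n) := by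
  have : Nonempty (Fin n) := ⟨⟨0, hn⟩⟩
  rw [Measure.addHaar_ball _ _ hr, finrank_euclideanSpace_fin, mul_pow, unitScale,
    Real.rpow_inv_natCast_pow ENNReal.toReal_nonneg (by omega), mul_comm,
    ENNReal.ofReal_mul ENNReal.toReal_nonneg, ENNReal.ofReal_toReal measure_ball_lt_top.ne]

lemma volume_closedBall_eq (hn : 1 ≤ n) (a : EuclideanSpace ℝ (Fin n)) {r : ℝ} (hr : 0 ≤ r) :
    volume (Metric.closedBall a r) = ENNReal.ofReal ((unitScale n * r) ^ n) := by
  have : Nonempty (Fin n) := ⟨⟨0, hn⟩⟩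
  rw [Measure.addHaar_closedBall_eq_addHaar_ball, volume_ball_eq hn a hr]

end Balls

/-! ### Comparison of local and global quasi-norms. -/

section LocalNorm

variable {n : ℕ} {Φ Ψ : ℝ → ℝ} {f : EuclideanSpace ℝ (Fin n) → ℝ}
  {a : EuclideanSpace ℝ (Fin n)} {r b : ℝ}

lemma iSup_level_le_one_iff (hr : 0 < r) :
    (⨆ (t : ℝ) (_ : 0 < t),
        ENNReal.ofReal (Ψ t) * volume {x | x ∈ Metric.ball a r ∧ t < |f x| / b}
          / volume (Metric.ball a r)) ≤ 1 ↔
      ∀ t, 0 < t → ENNReal.ofReal (Ψ t) * volume {x | x ∈ Metric.ball a r ∧ t < |f x| / b}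
        ≤ volume (Metric.ball a r) := by
  simp only [iSup_le_iff]
  refine forall₂_congr fun t _ => ?_
  rw [ENNReal.div_le_iff (Metric.measure_ball_pos _ _ hr).ne' measure_ball_lt_top.ne, one_mul]

lemma weakLocalNorm_le (hr : 0 < r) (hb : 0 < b)
    (h : ∀ t, 0 < t → ENNReal.ofReal (Ψ t) *
      volume {x | x ∈ Metric.ball a r ∧ t < |f x| / b} ≤ volume (Metric.ball a r)) :
    weakLocalNorm Ψ f a r ≤ ENNReal.ofReal b :=
  iInf₂_le b ⟨hb, (iSup_level_le_one_iff hr).2 h⟩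

lemma le_weakLocalNorm {c : ℝ≥0∞} (hr : 0 < r)
    (h : ∀ b : ℝ, 0 < b → (∀ t, 0 < t → ENNReal.ofReal (Ψ t) *
      volume {x | x ∈ Metric.ball a r ∧ t < |f x| / b} ≤ volume (Metric.ball a r)) →
      c ≤ ENNReal.ofReal b) :
    c ≤ weakLocalNorm Ψ f a r :=
  le_iInf₂ fun b hb => h b hb.1 ((iSup_level_le_one_iff hr).1 hb.2)

/-- If b is admissible for Ψ, then C * b is admissible for Φ: test level C * t. -/
lemma weakLocalNorm_le_mul {C : ℝ} (hC : 0 < C) (h : ∀ t, 0 < t → Φ t ≤ Ψ (C * t))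
    (hr : 0 < r) :
    weakLocalNorm Φ f a r ≤ ENNReal.ofReal C * weakLocalNorm Ψ f a r := by
  have hC' : ENNReal.ofReal C ≠ 0 := by simpa using hC
  rw [mul_comm, ← ENNReal.div_le_iff hC' ENNReal.ofReal_ne_top]
  refine le_weakLocalNorm hr fun b hb hadm => ?_
  rw [ENNReal.div_le_iff hC' ENNReal.ofReal_ne_top, ← ENNReal.ofReal_mul hb.le]
  refine weakLocalNorm_le hr (by positivity) fun t ht => ?_
  refine le_trans ?_ (hadm (C * t) (by positivity))
  refine mul_le_mul' (ENNReal.ofReal_le_ofReal (h t ht)) (measure_mono ?_)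
  rintro x ⟨hx, hxt⟩
  refine ⟨hx, ?_⟩
  rw [lt_div_iff₀ (by positivity)] at hxt ⊢
  linarith

lemma weakNorm_le_mul {φ ψ : ℝ → ℝ} {C D : ℝ} (hC : 0 < C)
    (h : ∀ t, 0 < t → Φ t ≤ Ψ (C * t)) (hD : 0 < D) (h' : ∀ t, 0 < t → φ t ≤ D * ψ t) :
    weakNorm φ Φ f ≤ ENNReal.ofReal (D * C) * weakNorm ψ Ψ f := by
  refine iSup_le fun a => iSup_le fun r => iSup_le fun hr => ?_
  have hv : 0 < (volume (Metric.ball a r)).toReal :=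
    ENNReal.toReal_pos (Metric.measure_ball_pos _ _ hr).ne' measure_ball_lt_top.ne
  calc _ ≤ ENNReal.ofReal (D * ψ (volume (Metric.ball a r)).toReal) *
        (ENNReal.ofReal C * weakLocalNorm Ψ f a r) :=
        mul_le_mul' (ENNReal.ofReal_le_ofReal (h' _ hv)) (weakLocalNorm_le_mul hC h hr)
    _ = ENNReal.ofReal (D * C) *
        (ENNReal.ofReal (ψ (volume (Metric.ball a r)).toReal) * weakLocalNorm Ψ f a r) := by
        rw [ENNReal.ofReal_mul hD.le, ENNReal.ofReal_mul hD.le]; ring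
    _ ≤ _ := by
        gcongr
        exact le_iSup_of_le a (le_iSup_of_le r (le_iSup_of_le hr le_rfl))

end LocalNorm

/-! ### The test function. -/

section Extremal

variable {n : ℕ} {Ψ ψ : ℝ → ℝ}

/-- The function `x ↦ 1 / ψ (|B(0, ‖x‖)|)`, set to `0` at the origin. -/
noncomputable def extremal (n : ℕ) (ψ : ℝ → ℝ) (x : EuclideanSpace ℝ (Fin n)) : ℝ :=
  (if 0 < ‖x‖ then ψ ((unitScale n * ‖x‖) ^ n) else 0)⁻¹

lemma extremal_of_ne {x : EuclideanSpace ℝ (Fin n)} (hx : x ≠ 0) :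
    extremal n ψ x = (ψ ((unitScale n * ‖x‖) ^ n))⁻¹ := by
  rw [extremal, if_pos (norm_pos_iff.2 hx)]

lemma measurable_extremal (hψ : MemG2 n Ψ ψ) : Measurable (extremal n ψ) := by
  have hw := unitScale_pos (n := n)
  -- Extension by 0 makes the radial profile monotone on all of ℝ, hence Borel.
  have hmono : Monotone fun ρ : ℝ => if 0 < ρ then ψ ((unitScale n * ρ) ^ n) else 0 := by
    intro ρ σ hρσ
    by_cases hρ : 0 < ρ
    · have hσ := hρ.trans_le hρσ
      simp only [hρ, hσ, if_true]
      exact hψ.monotoneOn (mem_Ioi.2 (by positivity)) (mem_Ioi.2 (by positivity)) (by gcongr)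
    · simp only [hρ, if_false]
      split_ifs with hσ
      · exact (hψ.pos _ (by positivity)).le
      · exact le_rfl
  exact (hmono.measurable.comp measurable_norm).inv

lemma weakLocalNorm_extremal_le (hn : 1 ≤ n) (hΨ : IsYoung Ψ) (hψ : MemG2 n Ψ ψ)
    (a : EuclideanSpace ℝ (Fin n)) {r : ℝ} (hr : 0 < r) :
    weakLocalNorm Ψ (extremal n ψ) a r ≤
      ENNReal.ofReal (growthConst n Ψ / ψ ((unitScale n * r) ^ n)) := by
  have hw := unitScale_pos (n := n)
  have hK := growthConst_pos (n := n) hΨ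
  have hψr := hψ.pos ((unitScale n * r) ^ n) (by positivity)
  refine weakLocalNorm_le hr (by positivity) fun t ht => ?_
  rcases le_or_gt (Ψ t) 1 with h1 | h1
  · calc _ ≤ 1 * volume (Metric.ball a r) :=
          mul_le_mul' (ENNReal.ofReal_le_one.2 h1) (measure_mono fun x hx => hx.1)
      _ = _ := one_mul _
  have hΨt : 0 < Ψ t := by linarith
  -- Chosen so that a ball of radius R has volume |B(a,r)| / Ψ t.
  set R : ℝ := r * ((Ψ t)⁻¹) ^ (n⁻¹ : ℝ) with hR
  have hR0 : 0 ≤ R := by positivity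
  have hRn : R ^ n = r ^ n / Ψ t := by
    rw [hR, mul_pow, Real.rpow_inv_natCast_pow (by positivity) (by omega), div_eq_mul_inv]
  have hsub : {x | x ∈ Metric.ball a r ∧ t < |extremal n ψ x| /
      (growthConst n Ψ / ψ ((unitScale n * r) ^ n))} ⊆ Metric.closedBall 0 R := by
    rintro x ⟨-, hx⟩
    rw [mem_closedBall_zero_iff]
    rcases eq_or_ne x 0 with rfl | hx0
    · simpa using hR0
    have hxn := norm_pos_iff.2 hx0
    have hψx := hψ.pos ((unitScale n * ‖x‖) ^ n) (by positivity)
    rw [extremal_of_ne hx0, abs_of_pos (by positivity), lt_div_iff₀ (by positivity),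
      lt_inv_comm₀ (by positivity) hψx] at hx
    have hlt : growthConst n Ψ * t * ψ ((unitScale n * ‖x‖) ^ n) <
        ψ ((unitScale n * r) ^ n) := by
      calc _ < growthConst n Ψ * t * (t * (growthConst n Ψ / ψ ((unitScale n * r) ^ n)))⁻¹ := by
            gcongr
        _ = _ := by field_simp
    have h2 := (hψ.map_le_one_or hΨ (by positivity) (by positivity) ht hlt).resolve_left
      (not_le.2 h1)
    refine le_of_pow_le_pow_left₀ (by omega : n ≠ 0) hR0 ?_
    rw [hRn, le_div_iff₀ hΨt]
    rw [mul_pow, mul_pow] at h2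
    refine le_of_mul_le_mul_left ?_ (pow_pos hw n)
    linarith
  calc _ ≤ ENNReal.ofReal (Ψ t) * ENNReal.ofReal ((unitScale n * R) ^ n) := by
        rw [← volume_closedBall_eq hn 0 hR0]
        gcongr
    _ = volume (Metric.ball a r) := by
        rw [volume_ball_eq hn a hr.le, ← ENNReal.ofReal_mul hΨt.le, mul_pow, hRn, mul_pow]
        congr 1
        field_simp

lemma extremal_mem_weakSpace (hn : 1 ≤ n) (hΨ : IsYoung Ψ) (hψ : MemG2 n Ψ ψ) :
    extremal n ψ ∈ weakSpace n ψ Ψ := by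
  refine ⟨(measurable_extremal hψ).aemeasurable, lt_of_le_of_lt
    (iSup_le fun a => iSup_le fun r => iSup_le fun hr => ?_)
    (ENNReal.ofReal_lt_top (r := growthConst n Ψ))⟩
  have hw := unitScale_pos (n := n)
  have hψr := hψ.pos ((unitScale n * r) ^ n) (by positivity)
  rw [volume_ball_eq hn a hr.le, ENNReal.toReal_ofReal (by positivity)]
  calc _ ≤ ENNReal.ofReal (ψ ((unitScale n * r) ^ n)) *
        ENNReal.ofReal (growthConst n Ψ / ψ ((unitScale n * r) ^ n)) := by
        gcongr
        exact weakLocalNorm_extremal_le hn hΨ hψ a hr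
    _ = _ := by
        rw [← ENNReal.ofReal_mul hψr.le]
        congr 1
        field_simp

lemma le_weakLocalNorm_extremal {Φ : ℝ → ℝ} (hn : 1 ≤ n) (hψ : MemG2 n Ψ ψ) {T : ℝ}
    (hT : 0 < T) (hΦ : ∀ y, T ≤ y → 1 < Φ y) {r : ℝ} (hr : 0 < r) :
    ENNReal.ofReal (T * ψ ((unitScale n * r) ^ n))⁻¹ ≤
      weakLocalNorm Φ (extremal n ψ) 0 r := by
  have : Nonempty (Fin n) := ⟨⟨0, hn⟩⟩
  have hw := unitScale_pos (n := n)
  have hψr := hψ.pos ((unitScale n * r) ^ n) (by positivity)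
  refine le_weakLocalNorm hr fun b hb hadm => ENNReal.ofReal_le_ofReal ?_
  by_contra! hcon
  have hlt : T < (ψ ((unitScale n * r) ^ n))⁻¹ / b := by
    rw [lt_div_iff₀ hb]
    calc T * b < T * (T * ψ ((unitScale n * r) ^ n))⁻¹ := by gcongr
      _ = _ := by field_simp
  -- The origin, where the function is 0, is removed; it is a null set.
  have hsub : Metric.ball 0 r \ {0} ⊆
      {x | x ∈ Metric.ball 0 r ∧ T < |extremal n ψ x| / b} := by
    rintro x ⟨hx, hx0 : x ≠ 0⟩
    refine ⟨hx, hlt.trans_le ?_⟩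
    have hxn := norm_pos_iff.2 hx0
    have hψx := hψ.pos ((unitScale n * ‖x‖) ^ n) (by positivity)
    rw [mem_ball_zero_iff] at hx
    rw [extremal_of_ne hx0, abs_of_pos (by positivity)]
    gcongr
    exact hψ.monotoneOn (mem_Ioi.2 (by positivity)) (mem_Ioi.2 (by positivity)) (by gcongr)
  have hvol : volume (Metric.ball (0 : EuclideanSpace ℝ (Fin n)) r) ≤
      volume {x | x ∈ Metric.ball 0 r ∧ T < |extremal n ψ x| / b} := by
    rw [← measure_sdiff_null (measure_singleton (0 : EuclideanSpace ℝ (Fin n)))]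
    exact measure_mono hsub
  have h1 := (mul_le_mul_right hvol (ENNReal.ofReal (Φ T))).trans (hadm T hT)
  refine absurd h1 (not_le.2 ?_)
  conv_lhs => rw [← one_mul (volume _)]
  exact ENNReal.mul_lt_mul_left (Metric.measure_ball_pos _ _ hr).ne' measure_ball_lt_top.ne
    (ENNReal.one_lt_ofReal.2 (hΦ T le_rfl))

lemma growthLE_of_weakNorm_extremal_lt_top {Φ φ : ℝ → ℝ} (hn : 1 ≤ n) (hΦ : IsYoung Φ)
    (hφ : MemG2 n Φ φ) (hψ : MemG2 n Ψ ψ) (h : weakNorm φ Φ (extremal n ψ) < ∞) :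
    GrowthLE φ ψ := by
  obtain ⟨T, hT, hT'⟩ := hΦ.exists_lt_map 1
  set N := (weakNorm φ Φ (extremal n ψ)).toReal with hN
  have hN0 : 0 ≤ N := ENNReal.toReal_nonneg
  have hw := unitScale_pos (n := n)
  -- The added 1 keeps the constant positive if N = 0.
  refine ⟨T * N + 1, by positivity, fun t ht => ?_⟩
  set r : ℝ := t ^ (n⁻¹ : ℝ) / unitScale n with hr
  have hr0 : 0 < r := by positivity
  have hrt : (unitScale n * r) ^ n = t := by
    rw [hr, mul_div_cancel₀ _ hw.ne', Real.rpow_inv_natCast_pow ht.le (by omega)]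
  have hψt := hψ.pos t ht
  have hφt := hφ.pos t ht
  have h1 := le_weakLocalNorm_extremal hn hψ hT hT' hr0
  rw [hrt] at h1
  have h2 : ENNReal.ofReal (φ t) * weakLocalNorm Φ (extremal n ψ) 0 r ≤
      weakNorm φ Φ (extremal n ψ) := by
    refine le_iSup_of_le 0 (le_iSup_of_le r (le_iSup_of_le hr0 ?_))
    rw [volume_ball_eq hn 0 hr0.le, ENNReal.toReal_ofReal (by positivity), hrt]
  have h3 : φ t * (T * ψ t)⁻¹ ≤ N := by
    rw [hN, ← ENNReal.ofReal_le_iff_le_toReal h.ne, ENNReal.ofReal_mul hφt.le]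
    exact (mul_le_mul_right h1 _).trans h2
  rw [← div_eq_mul_inv, div_le_iff₀ (by positivity)] at h3
  linarith

end Extremal

end OrliczMorrey

theorem theorem3p9 (n : ℕ) (hn : 1 ≤ n) (Ψ₁ Ψ₂ ψ₁ ψ₂ : ℝ → ℝ)
    (hΨ₁ : OrliczMorrey.IsYoung Ψ₁) (hΨ₂ : OrliczMorrey.IsYoung Ψ₂)
    (hΨ : OrliczMorrey.YoungLE Ψ₁ Ψ₂)
    (hψ₁ : OrliczMorrey.MemG2 n Ψ₁ ψ₁) (hψ₂ : OrliczMorrey.MemG2 n Ψ₂ ψ₂) :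
    List.TFAE
      [OrliczMorrey.GrowthLE ψ₁ ψ₂,
       OrliczMorrey.weakSpace n ψ₂ Ψ₂ ⊆ OrliczMorrey.weakSpace n ψ₁ Ψ₁,
       ∃ C : ℝ, 0 < C ∧ ∀ f ∈ OrliczMorrey.weakSpace n ψ₂ Ψ₂,
         OrliczMorrey.weakNorm ψ₁ Ψ₁ f ≤ ENNReal.ofReal C * OrliczMorrey.weakNorm ψ₂ Ψ₂ f] := by
  tfae_have 1 → 3 := by
    rintro ⟨D, hD, h'⟩
    obtain ⟨C, hC, h⟩ := hΨ
    exact ⟨D * C, by positivity, fun f _ => OrliczMorrey.weakNorm_le_mul hC h hD h'⟩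
  tfae_have 3 → 2 := by
    rintro ⟨C, hC, h⟩ f hf
    exact ⟨hf.1, (h f hf).trans_lt (ENNReal.mul_lt_top ENNReal.ofReal_lt_top hf.2)⟩
  tfae_have 2 → 1 := fun h =>
    OrliczMorrey.growthLE_of_weakNorm_extremal_lt_top hn hΨ₁ hψ₁ hψ₂
      (h (OrliczMorrey.extremal_mem_weakSpace hn hΨ₂ hψ₂)).2
  tfae_finish
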